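/- For $n\ge 1$ let $\Psi_{2n}$ be the convex hull of the symmetric $2n\times 2n$ permutation matrices with zero diagonal. For a real symmetric $2n\times 2n$ matrix $B=[b_{ij}]$ with zero diagonal and $0\le k\le n$, let $\mathrm{haf}_k(B)$ be the sum of the hafnians of all principal submatrices of $B$ of order $2k$, where the hafnian of a symmetric matrix of even order is the sum, over all perfect matchings $M$ of the complete graph on its index set, of $\prod_{\{i,j\}\in M} b_{ij}$. Equivalently, $\mathrm{haf}_k(B)$ is the total weight of all $k$-matchings of the complete graph $K_{2n}$ with edge weights $b_{ij}$. Let $n\ge 1$, and suppose that $B\in\Psi_{2n}$ has exactly one positive eigenvalue, counted with multiplicity. Then $$\mathrm{haf}_n(B)\ \ge\ \Big(\frac{n-1}{n}\Big)^{(n-1)n}$$ (where $0^0=1$ for $n=1$), and for every $k=2,\ldots,n-1$ $$\mathrm{haf}_k(B)\ \ge\ \frac{(2n)^{2n-2k}\,(2n-k)!\,(2n)^k}{(2n-2k)!\,(2n-k)^{2n-k}\,2^k\,k!}\Big(\frac{2n-k-1}{2n-k}\Big)^{(2n-k-1)k}.$$ Moreover, $\big(\frac{n-1}{n}\big)^{(n-1)n}\sim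 e^{-n}\sqrt e$ as $n\to\infty$, i.e. the ratio of the two sides tends to $1$. -/

import Mathlib

/-- The perfect matchings of the complete graph on a finite linearly ordered vertex set `V`.
The edge between `i` and `j` with `i < j` is represented by the ordered pair `(i, j)`; a perfect
matching is a set of edges such that every vertex lies on exactly one of them. -/
def perfectMatchings (V : Type*) [Fintype V] [LinearOrder V] : Finset (Finset (V × V)) :=
  Finset.univ.filter fun M =>
    (∀ e ∈ M, e.1 < e.2) ∧ ∀ v : V, (M.filter fun e => v = e.1 ∨ v = e.2).card = 1

/-- The hafnian of a (symmetric) matrix `B`: the sum over all perfect matchings of the product of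
the weights `B i j` of the edges of the matching. -/
def haf {R V : Type*} [CommSemiring R] [Fintype V] [LinearOrder V] (B : Matrix V V R) : R :=
  ∑ M ∈ perfectMatchings V, ∏ e ∈ M, B e.1 e.2

/-- `haf_k(B)`: the sum of the hafnians of all principal submatrices of `B` of order `2k`. -/
def hafK {R V : Type*} [CommSemiring R] [Fintype V] [LinearOrder V] (k : ℕ)
    (B : Matrix V V R) : R :=
  ∑ S ∈ Finset.powersetCard (2 * k) (Finset.univ : Finset V),
    haf (B.submatrix (fun i : S => (i : V)) (fun i : S => (i : V)))

/-- `Ψ_{2n}`: the convex hull of the symmetric `2n × 2n` permutation matrices with zero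
diagonal. -/
def Psi (n : ℕ) : Set (Matrix (Fin (2 * n)) (Fin (2 * n)) ℝ) :=
  convexHull ℝ {P | (∃ σ : Equiv.Perm (Fin (2 * n)), P = σ.permMatrix ℝ) ∧
    P.IsSymm ∧ ∀ i, P i i = 0}

/-- The real matrix `B` has exactly one positive eigenvalue, eigenvalues being counted with
multiplicity as roots of the characteristic polynomial. -/
def HasExactlyOnePosEigenvalue {V : Type*} [Fintype V] [DecidableEq V]
    (B : Matrix V V ℝ) : Prop :=
  (B.charpoly.roots.filter fun t : ℝ => 0 < t).card = 1

/-!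
The bound is an instance of Gurvits' capacity method. Let `B` have order `N`. Because `B` has only
one positive eigenvalue, its quadratic form satisfies a reversed Cauchy–Schwarz inequality, and
hence `p = (∑_{i < j} B i j x_i x_j) ^ k * (∑ x_i) ^ (N - 2 * k)` satisfies `|p z| ≥ p (Re z)` on
the right half-spaces: it is a half-plane stable form. Its coefficient at `∏ x_i` is
`k! (N - 2 * k)! haf_k B`. Since `B` is doubly stochastic, AM–GM gives
`p x ≥ (N / 2) ^ k * N ^ (N - 2 * k) * ∏ x_i` for positive `x`. Extracting from a stable form the
linear coefficient in one variable of degree at most `d` costs at most a factor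
`((d - 1) / d) ^ (d - 1)` in such a bound. With `j` variables left, `d` may be taken to be the
minimum of `j` and of the degree `N - k` of `p` in a single variable.
-/

section Univariate

open Polynomial

theorem norm_eval_le_norm_eval_of_roots {K : Type*} [NormedField K] {F : K[X]} (hF : F.Splits)
    {u v : K} (h : ∀ a ∈ F.roots, ‖u - a‖ ≤ ‖v - a‖) : ‖F.eval u‖ ≤ ‖F.eval v‖ := by
  have hnorm (x : K) : ‖F.eval x‖ = ‖F.leadingCoeff‖ * (F.roots.map fun a => ‖x - a‖).prod := by
    rw [hF.eval_eq_prod_roots, norm_mul]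
    exact congrArg (‖F.leadingCoeff‖ * ·)
      ((map_multiset_prod (normHom : K →*₀ ℝ) _).trans <| by rw [Multiset.map_map]; rfl)
  rw [hnorm, hnorm]
  gcongr
  exact Multiset.prod_map_le_prod_map₀ _ _ (fun a _ => norm_nonneg _) h

theorem derivative_eval_zero_ne_zero_of_roots_re_neg {F : ℂ[X]} (hF : 0 < F.degree)
    (h : ∀ a, F.IsRoot a → a.re < 0) : F.derivative.eval 0 ≠ 0 := by
  intro h0
  have hF' : F.derivative ≠ 0 := by
    rw [Ne, derivative_eq_zero]
    exact (natDegree_pos_iff_degree_pos.2 hF).ne'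
  have hhull : convexHull ℝ (F.rootSet ℂ) ⊆ {z : ℂ | z.re < 0} :=
    convexHull_min (fun a ha => h a (by simpa using (mem_rootSet.1 ha).2))
      (convex_halfSpace_re_lt 0)
  have hmem : (0 : ℂ) ∈ F.derivative.rootSet ℂ := mem_rootSet.2 ⟨hF', by simpa using h0⟩
  simpa using hhull (rootSet_derivative_subset_convexHull_rootSet hF hmem)

theorem le_norm_derivative_eval_zero {𝕜 : Type*} [RCLike 𝕜] {F : 𝕜[X]} {b : ℝ}
    (h0 : F.eval 0 = 0) (h : ∀ t : ℝ, 0 < t → b * t ≤ ‖F.eval (t : 𝕜)‖) :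
    b ≤ ‖F.derivative.eval 0‖ := by
  obtain ⟨G, rfl⟩ := X_dvd_iff.2 (coeff_zero_eq_eval_zero F ▸ h0)
  have hG : ∀ t ∈ Set.Ioi (0 : ℝ), b ≤ ‖G.eval (t : 𝕜)‖ := fun t (ht : 0 < t) => by
    have := h t ht
    rw [eval_mul, eval_X, norm_mul, RCLike.norm_ofReal, abs_of_pos ht, mul_comm] at this
    exact le_of_mul_le_mul_left this ht
  have hcont : Continuous fun t : ℝ => ‖G.eval (t : 𝕜)‖ := by fun_prop
  have hclosure := closure_minimal hG (isClosed_le continuous_const hcont)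
  rw [closure_Ioi] at hclosure
  have hzero : b ≤ ‖G.eval ((0 : ℝ) : 𝕜)‖ := hclosure Set.self_mem_Ici
  simpa using hzero

theorem derivative_eval_zero_ne_zero_of_linear_growth {F : ℂ[X]} {a b : ℝ} (ha : 0 < a)
    (hb : 0 < b) (h : ∀ t : ℂ, 0 ≤ t.re → a + b * t.re ≤ ‖F.eval t‖) :
    F.derivative.eval 0 ≠ 0 := by
  refine derivative_eval_zero_ne_zero_of_roots_re_neg ?_ fun t ht => ?_
  · by_contra hdeg
    rw [eq_C_of_degree_le_zero (not_lt.1 hdeg)] at h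
    have := h ((‖F.coeff 0‖ / b : ℝ) : ℂ) (by rw [Complex.ofReal_re]; positivity)
    rw [Complex.ofReal_re, eval_C, mul_div_cancel₀ _ hb.ne'] at this
    linarith
  · by_contra! hre
    have := h t hre
    rw [ht.eq_zero, norm_zero] at this
    nlinarith

theorem eval_zero_add_derivative_mul_le_eval {R : Type*} [CommSemiring R] [PartialOrder R]
    [IsOrderedRing R] {P : R[X]} (hP : ∀ k, 0 ≤ P.coeff k) {t : R} (ht : 0 ≤ t) :
    P.eval 0 + P.derivative.eval 0 * t ≤ P.eval t := by
  have hhigher : 0 ≤ ∑ k ∈ Finset.range P.natDegree, P.coeff (k + 1 + 1) * t ^ (k + 1 + 1) :=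
    Finset.sum_nonneg fun k _ => mul_nonneg (hP _) (pow_nonneg ht _)
  rw [eval_eq_sum_range' (n := P.natDegree + 2) (by omega) t, Finset.sum_range_succ',
    Finset.sum_range_succ', ← coeff_zero_eq_eval_zero, ← coeff_zero_eq_eval_zero, coeff_derivative,
    add_assoc, add_comm (P.coeff 0)]
  simpa using le_add_of_nonneg_left hhigher

end Univariate

section RealRooted

open Polynomial

theorem prod_le_arith_mean_pow_card (m : Multiset ℝ) (hm : ∀ b ∈ m, 0 ≤ b) :
    m.prod ≤ (m.sum / m.card) ^ m.card := by
  classical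
  rcases eq_or_ne m 0 with rfl | hm0
  · simp
  have hcard : 0 < m.card := Multiset.card_pos.2 hm0
  have hcount : ∑ b ∈ m.toFinset, (m.count b : ℝ) = m.card := by
    exact_mod_cast m.toFinset_sum_count_eq
  have hsum : ∑ b ∈ m.toFinset, (m.count b : ℝ) * b = m.sum := by
    simp [Finset.sum_multiset_count m]
  have hprod : ∏ b ∈ m.toFinset, b ^ (m.count b : ℝ) = m.prod := by
    simp [Finset.prod_multiset_count m]
  have hnonneg : ∀ b ∈ m.toFinset, 0 ≤ b := fun b hb => hm b (Multiset.mem_toFinset.1 hb)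
  have h := Real.geom_mean_le_arith_mean m.toFinset (fun b => m.count b) id
    (fun _ _ => Nat.cast_nonneg _) (by rw [hcount]; exact_mod_cast hcard) hnonneg
  simp only [id, hcount, hsum, hprod] at h
  have hpow := pow_le_pow_left₀ (Real.rpow_nonneg (Multiset.prod_nonneg hm) _) h m.card
  rwa [Real.rpow_inv_natCast_pow (Multiset.prod_nonneg hm) hcard.ne'] at hpow

theorem prod_one_add_le_one_add_sum_div_pow (m : Multiset ℝ) (hm : ∀ b ∈ m, 0 ≤ b) {d : ℕ}
    (hd : m.card ≤ d) : (m.map (1 + ·)).prod ≤ (1 + m.sum / d) ^ d := by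
  rcases Nat.eq_zero_or_pos d with rfl | hd0
  · simp [Multiset.card_eq_zero.1 (Nat.le_zero.1 hd)]
  have hd0' : (d : ℝ) ≠ 0 := by positivity
  have hpad := prod_le_arith_mean_pow_card ((m + Multiset.replicate (d - m.card) 0).map (1 + ·))
    fun b hb => by
      obtain ⟨a, ha, rfl⟩ := Multiset.mem_map.1 hb
      rcases Multiset.mem_add.1 ha with ha | ha
      · linarith [hm a ha]
      · simp [Multiset.eq_of_mem_replicate ha]
  have hcard : (m.card : ℝ) + ((d - m.card : ℕ) : ℝ) = d := by
    exact_mod_cast Nat.add_sub_cancel' hd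
  rw [Multiset.sum_map_add] at hpad
  simp only [Multiset.map_add, Multiset.prod_add, Multiset.map_replicate, add_zero,
    Multiset.prod_replicate, one_pow, mul_one, Multiset.map_const', Multiset.sum_replicate,
    Multiset.card_map, Multiset.card_add, Multiset.card_replicate, smul_zero,
    Multiset.map_id', Multiset.sum_add, nsmul_eq_mul, hcard,
    Nat.add_sub_cancel' hd] at hpad
  rwa [add_div, div_self hd0'] at hpad

theorem roots_neg_of_coeff_nonneg {R : ℝ[X]} (hR : ∀ k, 0 ≤ R.coeff k) (h0 : 0 < R.eval 0) :
    ∀ a ∈ R.roots, a < 0 := by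
  intro a ha
  by_contra! ha0
  have htangent := eval_zero_add_derivative_mul_le_eval hR ha0
  rw [(isRoot_of_mem_roots ha).eq_zero, ← coeff_zero_eq_eval_zero R.derivative,
    coeff_derivative] at htangent
  have := hR 1
  norm_num at htangent
  nlinarith

theorem eval_le_eval_zero_mul_pow {R : ℝ[X]} (hs : R.Splits) (hR : ∀ k, 0 ≤ R.coeff k) {d : ℕ}
    (hd : R.natDegree ≤ d) (h0 : 0 < R.eval 0) {t : ℝ} (ht : 0 ≤ t) :
    R.eval t ≤ R.eval 0 * (1 + R.derivative.eval 0 / R.eval 0 * t / d) ^ d := by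
  have hneg := roots_neg_of_coeff_nonneg hR h0
  have hfactor : R.eval t =
      R.eval 0 * ((R.roots.map fun a => 1 / (0 - a) * t).map (1 + ·)).prod := by
    rw [hs.eval_eq_prod_roots t, hs.eval_eq_prod_roots 0, mul_assoc, Multiset.map_map,
      ← Multiset.prod_map_mul]
    congr 2
    refine Multiset.map_congr rfl fun a ha => ?_
    have := (hneg a ha).ne
    simp only [Function.comp_apply]
    field_simp
    ring
  rw [hs.eval_derivative_eq_eval_mul_sum h0.ne', mul_div_cancel_left₀ _ h0.ne',
    ← Multiset.sum_map_mul_right, hfactor]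
  refine mul_le_mul_of_nonneg_left
    (prod_one_add_le_one_add_sum_div_pow _ (fun b hb => ?_) ?_) h0.le
  · obtain ⟨a, ha, rfl⟩ := Multiset.mem_map.1 hb
    exact mul_nonneg (div_nonneg zero_le_one (by linarith [hneg a ha])) ht
  · rw [Multiset.card_map]
    exact (card_roots' R).trans hd

/-- Gurvits' factor `((d - 1) / d) ^ (d - 1)`, the loss of capacity when a variable of degree at
most `d` is eliminated. With `0⁻¹ = 0` and `0 ^ 0 = 1` its value is `1` for `d = 0` and `d = 1`. -/
noncomputable def capacityFactor (d : ℕ) : ℝ := (((d : ℝ) - 1) / d) ^ (d - 1)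

theorem capacityFactor_pos (d : ℕ) : 0 < capacityFactor d := by
  rcases le_or_gt d 1 with hd | hd
  · simp [capacityFactor, Nat.sub_eq_zero_of_le hd]
  · have : (1 : ℝ) < d := by exact_mod_cast hd
    exact pow_pos (div_pos (by linarith) (by linarith)) _

theorem capacityFactor_le_one (d : ℕ) : capacityFactor d ≤ 1 := by
  rcases Nat.eq_zero_or_pos d with rfl | hd
  · simp [capacityFactor]
  · have : (1 : ℝ) ≤ d := by exact_mod_cast hd
    refine pow_le_one₀ (div_nonneg (by linarith) (by linarith)) ?_
    rw [div_le_one (by linarith)]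
    linarith

theorem capacityFactor_mul_le {d : ℕ} {a s c : ℝ} (hs : 0 ≤ s) (hc : 0 < c)
    (h : ∀ t, 0 < t → c * t ≤ a * (1 + s * t / d) ^ d) : capacityFactor d * c ≤ a * s := by
  rcases eq_or_ne (s / d) 0 with hsd | hsd
  · have := h ((|a| + 1) / c) (by positivity)
    rw [mul_div_cancel₀ _ hc.ne', mul_div_right_comm, hsd, zero_mul, add_zero, one_pow] at this
    linarith [le_abs_self a]
  obtain ⟨hs0, hd0⟩ := div_ne_zero_iff.1 hsd
  have hspos : 0 < s := hs.lt_of_ne' hs0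
  obtain ⟨r, rfl⟩ := Nat.exists_eq_succ_of_ne_zero (Nat.cast_ne_zero.1 hd0)
  simp only [Nat.succ_eq_add_one] at *
  -- With `y = 1 / t` the hypothesis extends to `y = 0`, where the optimum lies for `d = 1`.
  have hinv : ∀ y ∈ Set.Ioi (0 : ℝ), c * y ^ r ≤ a * (y + s / (r + 1 : ℕ)) ^ (r + 1) := by
    intro y (hy : 0 < y)
    have := mul_le_mul_of_nonneg_right (h y⁻¹ (inv_pos.2 hy)) (pow_nonneg hy.le (r + 1))
    rw [mul_assoc, mul_assoc, ← mul_pow, pow_succ', inv_mul_cancel_left₀ hy.ne'] at this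
    have hlin : (1 + s * y⁻¹ / (r + 1 : ℕ)) * y = y + s / (r + 1 : ℕ) := by field_simp
    rwa [hlin] at this
  have hclosure := closure_minimal hinv <| isClosed_le (f := fun y : ℝ => c * y ^ r)
    (g := fun y : ℝ => a * (y + s / (r + 1 : ℕ)) ^ (r + 1)) (by fun_prop) (by fun_prop)
  rw [closure_Ioi] at hclosure
  have hopt : c * (s * (r / (r + 1 : ℕ))) ^ r ≤
      a * (s * (r / (r + 1 : ℕ)) + s / (r + 1 : ℕ)) ^ (r + 1) :=
    hclosure (show 0 ≤ s * (r / (r + 1 : ℕ)) by positivity)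
  have hsum : s * (r / (r + 1 : ℕ)) + s / (r + 1 : ℕ) = s := by push_cast; field_simp
  rw [hsum, mul_pow, pow_succ' s] at hopt
  have hfactor : capacityFactor (r + 1) = (r / (r + 1 : ℕ)) ^ r := by simp [capacityFactor]
  rw [hfactor]
  refine le_of_mul_le_mul_right ?_ (pow_pos hspos r)
  linarith

theorem capacityFactor_mul_le_derivative_eval_zero {R : ℝ[X]} (hs : R.Splits)
    (hR : ∀ k, 0 ≤ R.coeff k) {d : ℕ} (hd : R.natDegree ≤ d) {c : ℝ} (hc : 0 < c)
    (h : ∀ t, 0 < t → c * t ≤ R.eval t) : capacityFactor d * c ≤ R.derivative.eval 0 := by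
  have hder : 0 ≤ R.derivative.eval 0 := by
    simpa [← coeff_zero_eq_eval_zero, coeff_derivative] using hR 1
  have heval : 0 ≤ R.eval 0 := by simpa [← coeff_zero_eq_eval_zero] using hR 0
  rcases heval.eq_or_lt with h0 | h0
  · have hcR := le_norm_derivative_eval_zero (𝕜 := ℝ) h0.symm fun t ht =>
      (h t ht).trans (le_abs_self _)
    rw [Real.norm_of_nonneg hder] at hcR
    exact (mul_le_of_le_one_left hc.le (capacityFactor_le_one d)).trans hcR
  · have := capacityFactor_mul_le (div_nonneg hder h0.le) hc fun t ht =>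
      (h t ht).trans (eval_le_eval_zero_mul_pow hs hR hd h0 ht.le)
    rwa [mul_div_cancel₀ _ h0.ne'] at this

theorem prod_range_capacityFactor (d : ℕ) :
    ∏ k ∈ Finset.range d, capacityFactor (k + 1) = (d.factorial : ℝ) / (d : ℝ) ^ d := by
  induction d with
  | zero => simp
  | succ d ih =>
    rw [Finset.prod_range_succ, ih, capacityFactor, Nat.add_sub_cancel, Nat.factorial_succ]
    push_cast
    rw [add_sub_cancel_right]
    rcases Nat.eq_zero_or_pos d with rfl | hd
    · simp
    · rw [div_pow, pow_succ]
      field_simp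

theorem prod_range_capacityFactor_min (d r : ℕ) :
    ∏ k ∈ Finset.range (d + r), capacityFactor (min d (k + 1)) =
      (d.factorial : ℝ) / (d : ℝ) ^ d * capacityFactor d ^ r := by
  rw [Finset.prod_range_add, ← prod_range_capacityFactor]
  congr 1
  · refine Finset.prod_congr rfl fun k hk => ?_
    rw [min_eq_right (Finset.mem_range.1 hk)]
  · rw [Finset.prod_congr rfl fun k _ => by rw [min_eq_left (by omega)], Finset.prod_const,
      Finset.card_range]

end RealRooted

section Evaluation

open MvPolynomial

variable {σ : Type*}

theorem aeval_smul_of_isHomogeneous {R A : Type*} [CommSemiring R] [CommSemiring A] [Algebra R A]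
    {p : MvPolynomial σ R} {e : ℕ} (hp : p.IsHomogeneous e) (c : A) (w : σ → A) :
    aeval (c • w) p = c ^ e * aeval w p := by
  simp only [aeval_def, eval₂_eq, Finset.mul_sum, Pi.smul_apply, smul_eq_mul, mul_pow,
    Finset.prod_mul_distrib]
  refine Finset.sum_congr rfl fun m hm => ?_
  rw [Finset.prod_pow_eq_pow_sum, ← hp.degree_eq_sum_deg_support hm]
  ring

theorem continuous_aeval {R A : Type*} [CommSemiring R] [CommSemiring A] [Algebra R A]
    [TopologicalSpace A] [IsTopologicalSemiring A] (p : MvPolynomial σ R) :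
    Continuous fun w : σ → A => aeval w p := by
  simp only [aeval_def, eval₂_eq_eval_map]
  exact continuous_eval _

theorem aeval_ofReal (p : MvPolynomial σ ℝ) (x : σ → ℝ) :
    aeval (fun j => (x j : ℂ)) p = ((aeval x p : ℝ) : ℂ) :=
  aeval_algebraMap_apply ℂ x p

theorem aeval_nonneg_of_coeff_nonneg {R : Type*} [CommSemiring R] [PartialOrder R]
    [IsOrderedRing R] {p : MvPolynomial σ R} (hp : ∀ m, 0 ≤ p.coeff m) {x : σ → R}
    (hx : ∀ j, 0 ≤ x j) : 0 ≤ aeval x p := by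
  rw [aeval_def, eval₂_eq]
  exact Finset.sum_nonneg fun m _ =>
    mul_nonneg (hp m) (Finset.prod_nonneg fun j _ => pow_nonneg (hx j) _)

theorem aeval_eq_zero_of_coeff_nonneg {A : Type*} [CommSemiring A] [Algebra ℝ A]
    {p : MvPolynomial σ ℝ} (hp : ∀ m, 0 ≤ p.coeff m) {x : σ → ℝ} (hx : ∀ j, 0 ≤ x j)
    (h0 : aeval x p = 0) {z : σ → A} (hz : ∀ j, x j = 0 → z j = 0) : aeval z p = 0 := by
  rw [aeval_def, eval₂_eq] at h0 ⊢
  have hterm := (Finset.sum_eq_zero_iff_of_nonneg fun m _ =>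
    mul_nonneg (hp m) (Finset.prod_nonneg fun j _ => pow_nonneg (hx j) _)).1 h0
  refine Finset.sum_eq_zero fun m hm => ?_
  obtain ⟨j, hj, hxj⟩ := Finset.prod_eq_zero_iff.1
    ((mul_eq_zero.1 (hterm m hm)).resolve_left (mem_support_iff.1 hm))
  have hmj : m j ≠ 0 := Finsupp.mem_support_iff.1 hj
  exact mul_eq_zero_of_right _
    (Finset.prod_eq_zero hj (by rw [hz j ((pow_eq_zero_iff hmj).1 hxj), zero_pow hmj]))

end Evaluation

section Slice

open MvPolynomial

variable {σ R : Type*} [DecidableEq σ] [CommSemiring R]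

/-- The univariate polynomial obtained from `p` by substituting `w j` for every variable `X j`
with `j ≠ i`. -/
noncomputable def univariateSlice {A : Type*} [CommSemiring A] [Algebra R A] (i : σ) (w : σ → A)
    (p : MvPolynomial σ R) : Polynomial A :=
  aeval (Function.update (fun j => Polynomial.C (w j)) i Polynomial.X) p

/-- The coefficient of `X i` in `p`, where `p` is regarded as a polynomial in `X i` over the
polynomials in the other variables. -/
noncomputable def linearCoeff (i : σ) (p : MvPolynomial σ R) : MvPolynomial σ R :=
  aeval (Function.update X i 0) (pderiv i p)

theorem aeval_univariateSlice {A B : Type*} [CommSemiring A] [Algebra R A] [CommSemiring B]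
    [Algebra R B] [Algebra A B] [IsScalarTower R A B] (i : σ) (w : σ → A) (p : MvPolynomial σ R)
    (t : B) : Polynomial.aeval t (univariateSlice i w p) =
      aeval (Function.update (fun j => algebraMap A B (w j)) i t) p := by
  have hcomp := comp_aeval_apply (Function.update (fun j => Polynomial.C (w j)) i Polynomial.X)
    ((Polynomial.aeval (R := A) t).restrictScalars R) p
  refine hcomp.trans (congrArg (aeval · p) (funext fun j => ?_))
  rcases eq_or_ne j i with rfl | hj <;> simp [*]

theorem eval_univariateSlice {A : Type*} [CommSemiring A] [Algebra R A] (i : σ) (w : σ → A)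
    (p : MvPolynomial σ R) (t : A) :
    (univariateSlice i w p).eval t = aeval (Function.update w i t) p := by
  simpa using aeval_univariateSlice (B := A) i w p t

theorem derivative_univariateSlice {A : Type*} [CommSemiring A] [Algebra R A] (i : σ) (w : σ → A)
    (p : MvPolynomial σ R) :
    (univariateSlice i w p).derivative = univariateSlice i w (pderiv i p) := by
  unfold univariateSlice
  induction p using MvPolynomial.induction_on with
  | C a =>
    rw [pderiv_C, map_zero, algHom_C, Polynomial.algebraMap_apply, Polynomial.derivative_C]
  | add p q hp hq => simp only [map_add, hp, hq]
  | mul_X p j hp =>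
    rw [Derivation.leibniz, pderiv_X, map_mul, Polynomial.derivative_mul, hp]
    rcases eq_or_ne j i with rfl | hj
    · simp [mul_comm, add_comm]
    · simp [hj, mul_comm]

theorem aeval_linearCoeff {A : Type*} [CommSemiring A] [Algebra R A] (i : σ) (w : σ → A)
    (p : MvPolynomial σ R) :
    aeval w (linearCoeff i p) = (univariateSlice i w p).derivative.eval 0 := by
  rw [derivative_univariateSlice, eval_univariateSlice, linearCoeff, comp_aeval_apply]
  refine congrArg (aeval · _) (funext fun j => ?_)
  rcases eq_or_ne j i with rfl | hj <;> simp [*]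

theorem univariateSlice_eq_sum {A : Type*} [CommSemiring A] [Algebra R A] (i : σ)
    (w : σ → A) (p : MvPolynomial σ R) :
    univariateSlice i w p = ∑ m ∈ p.support, Polynomial.monomial (m i)
      (algebraMap R A (p.coeff m) * ∏ j ∈ m.support.erase i, w j ^ m j) := by
  rw [univariateSlice, aeval_def, eval₂_eq]
  refine Finset.sum_congr rfl fun m _ => ?_
  have hsplit : ∏ j ∈ m.support,
      Function.update (fun j => Polynomial.C (w j)) i Polynomial.X j ^ m j =
        Polynomial.X ^ m i * ∏ j ∈ m.support.erase i, Polynomial.C (w j) ^ m j := by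
    have hfactor := m.mul_prod_erase' i
      (fun j k => Function.update (fun j => Polynomial.C (w j)) i Polynomial.X j ^ k)
      fun j => pow_zero _
    rw [Function.update_self] at hfactor
    refine hfactor.symm.trans (congrArg _ ?_)
    rw [Finsupp.prod, Finsupp.support_erase]
    refine Finset.prod_congr rfl fun j hj => ?_
    rw [Finsupp.erase_ne (Finset.ne_of_mem_erase hj),
      Function.update_of_ne (Finset.ne_of_mem_erase hj)]
  rw [hsplit, ← Polynomial.C_mul_X_pow_eq_monomial, Polynomial.algebraMap_apply, map_mul,
    map_prod]
  simp only [map_pow]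
  ring

theorem natDegree_univariateSlice_le {A : Type*} [CommSemiring A] [Algebra R A]
    (i : σ) (w : σ → A) (p : MvPolynomial σ R) :
    (univariateSlice i w p).natDegree ≤ degreeOf i p := by
  rw [univariateSlice_eq_sum]
  exact Polynomial.natDegree_sum_le_of_forall_le _ _ fun m hm =>
    (Polynomial.natDegree_monomial_le _).trans (monomial_le_degreeOf i hm)

theorem coeff_univariateSlice_nonneg [PartialOrder R] [IsOrderedRing R] (i : σ)
    {x : σ → R} (hx : ∀ j, 0 ≤ x j) {p : MvPolynomial σ R} (hp : ∀ m, 0 ≤ p.coeff m) (k : ℕ) :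
    0 ≤ (univariateSlice i x p).coeff k := by
  rw [univariateSlice_eq_sum, Polynomial.finsetSum_coeff]
  refine Finset.sum_nonneg fun m _ => ?_
  rw [Polynomial.coeff_monomial]
  split_ifs
  · exact mul_nonneg (hp m) (Finset.prod_nonneg fun j _ => pow_nonneg (hx j) _)
  · exact le_rfl

theorem aeval_linearCoeff_mul_le [PartialOrder R] [IsOrderedRing R] (i : σ)
    {x : σ → R} (hx : ∀ j, 0 ≤ x j) {p : MvPolynomial σ R} (hp : ∀ m, 0 ≤ p.coeff m) {t : R}
    (ht : 0 ≤ t) : aeval (Function.update x i 0) p + aeval x (linearCoeff i p) * t ≤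
      aeval (Function.update x i t) p := by
  rw [aeval_linearCoeff, ← eval_univariateSlice, ← eval_univariateSlice]
  exact eval_zero_add_derivative_mul_le_eval (coeff_univariateSlice_nonneg i hx hp) ht

theorem aeval_update_zero_monomial (i : σ) (u : σ →₀ ℕ) (a : R) :
    aeval (Function.update X i 0) (monomial u a) = if u i = 0 then monomial u a else 0 := by
  rw [aeval_monomial]
  split_ifs with hu
  · rw [monomial_eq]
    refine congrArg _ (Finset.prod_congr rfl fun j hj => ?_)
    have hji : j ≠ i := fun h => Finsupp.mem_support_iff.1 hj (h ▸ hu)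
    simp only [Function.update_of_ne hji]
  · refine mul_eq_zero_of_right _ (Finset.prod_eq_zero (Finsupp.mem_support_iff.2 hu) ?_)
    simp only [Function.update_self, zero_pow hu]

theorem coeff_aeval_update_zero (i : σ) (p : MvPolynomial σ R) (m : σ →₀ ℕ) :
    (aeval (Function.update X i 0) p : MvPolynomial σ R).coeff m =
      if m i = 0 then p.coeff m else 0 := by
  induction p using MvPolynomial.induction_on' with
  | monomial u a =>
    rw [aeval_update_zero_monomial, apply_ite (coeff m), coeff_monomial, coeff_zero]
    rcases eq_or_ne u m with rfl | hum <;> simp [*]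
  | add p q hp hq =>
    rw [map_add, coeff_add, coeff_add, hp, hq]
    split_ifs <;> simp

theorem coeff_linearCoeff (i : σ) (p : MvPolynomial σ R) (m : σ →₀ ℕ) :
    (linearCoeff i p).coeff m = if m i = 0 then p.coeff (m + Finsupp.single i 1) else 0 := by
  rw [linearCoeff, coeff_aeval_update_zero, coeff_pderiv]
  split_ifs with h <;> simp [h]

theorem degreeOf_linearCoeff_le (i j : σ) (p : MvPolynomial σ R) :
    degreeOf j (linearCoeff i p) ≤ degreeOf j p := by
  refine degreeOf_le_iff.2 fun m hm => ?_
  rw [mem_support_iff, coeff_linearCoeff] at hm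
  have hmem : m + Finsupp.single i 1 ∈ p.support :=
    mem_support_iff.2 fun h0 => hm (by rw [h0, ite_self])
  exact le_trans (by simp) (monomial_le_degreeOf j hmem)

theorem isHomogeneous_linearCoeff {p : MvPolynomial σ R} {e : ℕ} (hp : p.IsHomogeneous (e + 1))
    (i : σ) : (linearCoeff i p).IsHomogeneous e := by
  have hvar (j : σ) : (Function.update X i 0 j : MvPolynomial σ R).IsHomogeneous 1 := by
    rcases eq_or_ne j i with rfl | hj
    · simpa using isHomogeneous_zero _ _ _
    · simpa [hj] using isHomogeneous_X _ _
  simpa [linearCoeff] using (hp.pderiv (i := i)).aeval _ hvar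

end Slice

section Stability

open MvPolynomial

variable {σ : Type*}

/-- A homogeneous polynomial of degree `e` with nonnegative coefficients that is stable with
respect to the right half-plane. Stability is expressed by the inequality `p (Re z) ≤ ‖p z‖`, which
for homogeneous `p ≠ 0` is equivalent to `p` having no zero `z` with `0 < Re (z j)` for all `j`, but
which holds for `p = 0`, too. -/
structure IsStableForm (p : MvPolynomial σ ℝ) (e : ℕ) : Prop where
  coeff_nonneg : ∀ m, 0 ≤ p.coeff m
  isHomogeneous : p.IsHomogeneous e
  le_norm_of_pos : ∀ z : σ → ℂ, (∀ j, 0 < (z j).re) → aeval (fun j => (z j).re) p ≤ ‖aeval z p‖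

theorem IsStableForm.le_norm {p : MvPolynomial σ ℝ} {e : ℕ} (hp : IsStableForm p e) {z : σ → ℂ}
    (hz : ∀ j, 0 ≤ (z j).re) : aeval (fun j => (z j).re) p ≤ ‖aeval z p‖ := by
  have hshift : ∀ t ∈ Set.Ioi (0 : ℝ),
      aeval (fun j => (z j).re + t) p ≤ ‖aeval (fun j => z j + (t : ℂ)) p‖ :=
    fun t (ht : 0 < t) => by
      simpa using hp.le_norm_of_pos (fun j => z j + (t : ℂ)) fun j => by
        simpa using add_pos_of_nonneg_of_pos (hz j) ht
  have hclosure := closure_minimal hshift <| isClosed_le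
    ((continuous_aeval p).comp (by fun_prop)) ((continuous_aeval p).comp (by fun_prop)).norm
  rw [closure_Ioi] at hclosure
  have hzero : aeval (fun j => (z j).re + 0) p ≤ ‖aeval (fun j => z j + ((0 : ℝ) : ℂ)) p‖ :=
    hclosure Set.self_mem_Ici
  simpa using hzero

theorem re_eq_zero_of_aeval_line_eq_zero {p : MvPolynomial σ ℝ} {e : ℕ} (hp : p.IsHomogeneous e)
    {x y : σ → ℝ} (h : ∀ z : σ → ℂ, (∀ j, (z j).re = x j) → aeval z p ≠ 0) {a : ℂ}
    (ha : aeval (fun j => (x j : ℂ) + y j * Complex.I * a) p = 0) : a.re = 0 := by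
  by_contra hre
  have ha0 : a ≠ 0 := fun h0 => hre (by rw [h0, Complex.zero_re])
  have hinv : a⁻¹.re ≠ 0 := by
    rw [Complex.inv_re]
    exact div_ne_zero hre (Complex.normSq_pos.2 ha0).ne'
  -- Rescaling by a multiple of `a⁻¹` moves the zero into the fibre of `Re` over `x`.
  refine h ((a⁻¹ / a⁻¹.re) • fun j => (x j : ℂ) + y j * Complex.I * a) (fun j => ?_)
    (by rw [aeval_smul_of_isHomogeneous hp, ha, mul_zero])
  have hscale : a⁻¹ / a⁻¹.re * (x j + y j * Complex.I * a) =
      a⁻¹ * ((x j / a⁻¹.re : ℝ) : ℂ) + ((y j / a⁻¹.re : ℝ) : ℂ) * Complex.I := by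
    push_cast
    field_simp
  rw [Pi.smul_apply, smul_eq_mul, hscale, Complex.add_re, Complex.re_mul_ofReal,
    Complex.re_ofReal_mul, Complex.I_re, mul_zero, add_zero, mul_div_cancel₀ _ hinv]

theorem norm_aeval_re_le_of_forall_aeval_ne_zero {p : MvPolynomial σ ℝ} {e : ℕ}
    (hp : p.IsHomogeneous e) {x : σ → ℝ}
    (h : ∀ z : σ → ℂ, (∀ j, (z j).re = x j) → aeval z p ≠ 0) {z : σ → ℂ}
    (hz : ∀ j, (z j).re = x j) : ‖aeval (fun j => (x j : ℂ)) p‖ ≤ ‖aeval z p‖ := by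
  let F : Polynomial ℂ := aeval (fun j => Polynomial.C (x j : ℂ) +
    Polynomial.C ((z j).im * Complex.I) * Polynomial.X) p
  have hF (s : ℂ) : F.eval s = aeval (fun j => (x j : ℂ) + (z j).im * Complex.I * s) p :=
    (comp_aeval_apply _ ((Polynomial.aeval (R := ℂ) s).restrictScalars ℝ) p).trans
      (congrArg (aeval · p) (funext fun j => by simp))
  have hroot : ∀ a ∈ F.roots, ‖0 - a‖ ≤ ‖1 - a‖ := fun a ha => by
    have hre := re_eq_zero_of_aeval_line_eq_zero hp h
      ((hF a).symm.trans (Polynomial.isRoot_of_mem_roots ha))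
    calc ‖0 - a‖ = |(1 - a).im| := by simpa using (Complex.abs_im_eq_norm.2 hre).symm
      _ ≤ ‖1 - a‖ := Complex.abs_im_le_norm _
  have hends := norm_eval_le_norm_eval_of_roots (IsAlgClosed.splits F) hroot
  rw [hF, hF] at hends
  simpa [← hz] using hends

theorem exists_re_pos_and_mul_re_pos {a : ℂ} (ha : a ∈ Complex.slitPlane) :
    ∃ c : ℂ, 0 < c.re ∧ 0 < (c * a).re := by
  have hsum : 0 < ‖a‖ + a.re := by
    rcases Complex.mem_slitPlane_iff.1 ha with hre | him
    · positivity
    · linarith [neg_abs_le a.re, Complex.abs_re_lt_norm.2 him]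
  have hmul : ((‖a‖ + (starRingEnd ℂ) a) * a).re = ‖a‖ * (‖a‖ + a.re) := by
    rw [add_mul, mul_comm ((starRingEnd ℂ) a), Complex.mul_conj, Complex.normSq_eq_norm_sq,
      Complex.add_re, Complex.re_ofReal_mul, Complex.ofReal_re]
    ring
  refine ⟨‖a‖ + (starRingEnd ℂ) a, by simpa using hsum, ?_⟩
  rw [hmul]
  exact mul_pos (norm_pos_iff.2 (Complex.slitPlane_ne_zero ha)) hsum

section Elimination

variable [DecidableEq σ]

theorem IsStableForm.splits_univariateSlice {p : MvPolynomial σ ℝ} {e : ℕ} (hp : IsStableForm p e)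
    (hpos : ∀ x : σ → ℝ, (∀ j, 0 < x j) → 0 < aeval x p) (i : σ) {x : σ → ℝ}
    (hx : ∀ j, 0 < x j) : (univariateSlice i x p).Splits := by
  refine Polynomial.Splits.of_splits_map (algebraMap ℝ ℂ) (IsAlgClosed.splits _) fun a ha => ?_
  have hroot : aeval (Function.update (fun j => algebraMap ℝ ℂ (x j)) i a) p = 0 := by
    rw [← aeval_univariateSlice, Polynomial.aeval_def, ← Polynomial.eval_map]
    exact Polynomial.isRoot_of_mem_roots ha
  suffices a ∉ Complex.slitPlane by
    rw [Complex.mem_slitPlane_iff, not_or, not_not] at this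
    exact ⟨a.re, Complex.ext rfl this.2.symm⟩
  intro hslit
  obtain ⟨c, hc, hca⟩ := exists_re_pos_and_mul_re_pos hslit
  have hw : ∀ j, 0 < ((c • Function.update (fun j => algebraMap ℝ ℂ (x j)) i a) j).re := by
    intro j
    rcases eq_or_ne j i with rfl | hj
    · simpa using hca
    · simpa [hj] using mul_pos hc (hx j)
  have hle := hp.le_norm_of_pos _ hw
  rw [aeval_smul_of_isHomogeneous hp.isHomogeneous, hroot, mul_zero, norm_zero] at hle
  exact (hpos _ hw).not_ge hle

theorem IsStableForm.aeval_add_linearCoeff_mul_le_norm {p : MvPolynomial σ ℝ} {e : ℕ}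
    (hp : IsStableForm p e) (i : σ) {z : σ → ℂ} (hz : ∀ j, 0 ≤ (z j).re) {t : ℂ}
    (ht : 0 ≤ t.re) :
    aeval (Function.update (fun j => (z j).re) i 0) p +
      aeval (fun j => (z j).re) (linearCoeff i p) * t.re ≤ ‖(univariateSlice i z p).eval t‖ := by
  have hre : (fun j => (Function.update z i t j).re) =
      Function.update (fun j => (z j).re) i t.re := by
    ext j
    rcases eq_or_ne j i with rfl | hj <;> simp [*]
  rw [eval_univariateSlice]
  refine (aeval_linearCoeff_mul_le i hz hp.coeff_nonneg ht).trans (hre ▸ hp.le_norm fun j => ?_)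
  rcases eq_or_ne j i with rfl | hj <;> simp [*]

theorem IsStableForm.aeval_linearCoeff_ne_zero {p : MvPolynomial σ ℝ} {e : ℕ}
    (hp : IsStableForm p e) (i : σ) {z : σ → ℂ} (hz : ∀ j, 0 < (z j).re)
    (hlin : 0 < aeval (fun j => (z j).re) (linearCoeff i p)) : aeval z (linearCoeff i p) ≠ 0 := by
  set x : σ → ℝ := fun j => (z j).re with hx
  have hgrowth := fun {t : ℂ} (ht : 0 ≤ t.re) =>
    hp.aeval_add_linearCoeff_mul_le_norm i (fun j => (hz j).le) ht
  have hx0 : ∀ j, 0 ≤ Function.update x i 0 j := fun j => by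
    rcases eq_or_ne j i with rfl | hj
    · simp
    · simpa [hj] using (hz j).le
  rw [aeval_linearCoeff]
  rcases (aeval_nonneg_of_coeff_nonneg hp.coeff_nonneg hx0).eq_or_lt with h0 | h0
  · have hzero : (univariateSlice i z p).eval 0 = 0 := by
      rw [eval_univariateSlice]
      refine aeval_eq_zero_of_coeff_nonneg hp.coeff_nonneg hx0 h0.symm fun j hj => ?_
      rcases eq_or_ne j i with rfl | hji
      · simp
      · rw [Function.update_of_ne hji] at hj
        exact absurd hj (hz j).ne'
    refine norm_pos_iff.1 (hlin.trans_le (le_norm_derivative_eval_zero hzero fun t ht => ?_))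
    simpa [← hx, ← h0] using hgrowth (t := (t : ℂ)) (by simpa using ht.le)
  · exact derivative_eval_zero_ne_zero_of_linear_growth h0 hlin fun t ht => hgrowth ht

theorem IsStableForm.linearCoeff {p : MvPolynomial σ ℝ} {e : ℕ} (hp : IsStableForm p (e + 1))
    (i : σ) : IsStableForm (linearCoeff i p) e where
  coeff_nonneg m := by
    rw [coeff_linearCoeff]
    split_ifs
    exacts [hp.coeff_nonneg _, le_rfl]
  isHomogeneous := isHomogeneous_linearCoeff hp.isHomogeneous i
  le_norm_of_pos z hz := by
    rcases le_or_gt (aeval (fun j => (z j).re) (_root_.linearCoeff i p)) 0 with h0 | h0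
    · exact h0.trans (norm_nonneg _)
    have hmin := norm_aeval_re_le_of_forall_aeval_ne_zero
      (isHomogeneous_linearCoeff hp.isHomogeneous i) (z := z)
      (fun w hw => hp.aeval_linearCoeff_ne_zero i (fun j => hw j ▸ hz j) (by simpa [hw] using h0))
      fun j => rfl
    rw [aeval_ofReal, Complex.norm_real] at hmin
    exact (le_abs_self _).trans hmin

theorem IsStableForm.capacityFactor_mul_le_aeval_linearCoeff {p : MvPolynomial σ ℝ} {e d : ℕ}
    (hp : IsStableForm p e) (i : σ) (hd : degreeOf i p ≤ d) {T : Finset σ} (hi : i ∉ T)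
    {c : ℝ} (hc : 0 < c)
    (hcap : ∀ x : σ → ℝ, (∀ j, 0 < x j) → c * ∏ j ∈ insert i T, x j ≤ aeval x p)
    {x : σ → ℝ} (hx : ∀ j, 0 < x j) :
    capacityFactor (min d e) * c * ∏ j ∈ T, x j ≤ aeval x (_root_.linearCoeff i p) := by
  have hpos : ∀ y : σ → ℝ, (∀ j, 0 < y j) → 0 < aeval y p := fun y hy =>
    (mul_pos hc (Finset.prod_pos fun j _ => hy j)).trans_le (hcap y hy)
  have hdeg : (univariateSlice i x p).natDegree ≤ min d e :=
    (natDegree_univariateSlice_le i x p).trans <| le_min hd <|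
      (degreeOf_le_totalDegree p i).trans hp.isHomogeneous.totalDegree_le
  rw [aeval_linearCoeff, mul_assoc]
  refine capacityFactor_mul_le_derivative_eval_zero (hp.splits_univariateSlice hpos i hx)
    (coeff_univariateSlice_nonneg i (fun j => (hx j).le) hp.coeff_nonneg) hdeg
    (mul_pos hc (Finset.prod_pos fun j _ => hx j)) fun t ht => ?_
  have hcap_update := hcap (Function.update x i t) fun j => by
    rcases eq_or_ne j i with rfl | hj <;> simp [*]
  rw [Finset.prod_insert hi, Function.update_self, Finset.prod_update_of_notMem hi] at hcap_update
  rw [eval_univariateSlice]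
  linarith

end Elimination

theorem IsStableForm.mul_prod_capacityFactor_le_coeff (d : ℕ) (T : Finset σ)
    {p : MvPolynomial σ ℝ} (hp : IsStableForm p T.card) (hd : ∀ i, degreeOf i p ≤ d) {c : ℝ}
    (hc : 0 < c) (hcap : ∀ x : σ → ℝ, (∀ j, 0 < x j) → c * ∏ j ∈ T, x j ≤ aeval x p) :
    c * ∏ k ∈ Finset.range T.card, capacityFactor (min d (k + 1)) ≤
      p.coeff (∑ j ∈ T, Finsupp.single j 1) := by
  classical
  induction T using Finset.induction_on generalizing p c with
  | empty =>
    have hconst := totalDegree_eq_zero_iff_eq_C.1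
      ((totalDegree_zero_iff_isHomogeneous _).2 (by simpa using hp.isHomogeneous))
    have hcap_one := hcap (fun _ => 1) fun _ => one_pos
    rw [hconst] at hcap_one
    simpa using hcap_one
  | insert i T hi ih =>
    rw [Finset.card_insert_of_notMem hi] at hp ⊢
    have hsum : (∑ j ∈ T, Finsupp.single j 1 : σ →₀ ℕ) i = 0 := by
      rw [Finsupp.finsetSum_apply]
      exact Finset.sum_eq_zero fun j hj => Finsupp.single_eq_of_ne fun h => hi (h ▸ hj)
    have hrec := ih (hp.linearCoeff i) (fun j => (degreeOf_linearCoeff_le i j p).trans (hd j))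
      (mul_pos (capacityFactor_pos _) hc) fun x hx =>
        hp.capacityFactor_mul_le_aeval_linearCoeff i (hd i) hi hc hcap hx
    rw [coeff_linearCoeff, if_pos hsum] at hrec
    rw [Finset.prod_range_succ, Finset.sum_insert hi, add_comm (Finsupp.single i 1)]
    linarith

end Stability

section Lorentzian

/-- A bilinear form is Lorentzian if it is nonpositive on the kernel of some linear functional, that
is, if it is positive definite on no plane. -/
def IsLorentzian {E : Type*} [AddCommGroup E] [Module ℝ E] (β : LinearMap.BilinForm ℝ E) : Prop :=
  ∃ φ : E →ₗ[ℝ] ℝ, ∀ w, φ w = 0 → β w w ≤ 0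

theorem IsLorentzian.mul_le_sq {E : Type*} [AddCommGroup E] [Module ℝ E]
    {β : LinearMap.BilinForm ℝ E} (hβ : IsLorentzian β) (hsymm : β.IsSymm) {x : E}
    (hx : 0 < β x x) (y : E) : β x x * β y y ≤ β x y ^ 2 := by
  obtain ⟨φ, hφ⟩ := hβ
  have hφx : φ x ≠ 0 := fun h => (hφ x h).not_gt hx
  have hcomb := hφ (φ y • x - φ x • y) (by simp [mul_comm])
  have hyx : β y x = β x y := hsymm.eq y x
  simp only [map_sub, map_smul, LinearMap.sub_apply, LinearMap.smul_apply, smul_eq_mul,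
    hyx] at hcomb
  have hscaled : φ x ^ 2 * (β x x * β y y - β x y ^ 2) ≤ 0 := by
    nlinarith [mul_nonpos_of_nonneg_of_nonpos hx.le hcomb,
      sq_nonneg (φ y * β x x - φ x * β x y)]
  exact sub_nonpos.1 (nonpos_of_mul_nonpos_right hscaled (sq_pos_of_ne_zero hφx))

theorem IsLorentzian.sq_le_sq_sub_add_sq {E : Type*} [AddCommGroup E] [Module ℝ E]
    {β : LinearMap.BilinForm ℝ E} (hβ : IsLorentzian β) (hsymm : β.IsSymm) {x : E}
    (hx : 0 ≤ β x x) (y : E) : β x x ^ 2 ≤ (β x x - β y y) ^ 2 + (2 * β x y) ^ 2 := by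
  rcases hx.eq_or_lt with h0 | h0
  · rw [← h0, zero_pow two_ne_zero]
    positivity
  rcases le_or_gt (β y y) 0 with hy | hy
  · nlinarith [sq_nonneg (β x y)]
  · nlinarith [hβ.mul_le_sq hsymm h0 y]

variable {V : Type*} [Fintype V] [DecidableEq V]

theorem HasExactlyOnePosEigenvalue.isLorentzian {B : Matrix V V ℝ}
    (h : HasExactlyOnePosEigenvalue B) (hB : B.IsSymm) : IsLorentzian B.toBilin' := by
  have hH : B.IsHermitian := (Matrix.conjTranspose_eq_transpose_of_trivial B).trans hB
  obtain ⟨i₀, hi₀⟩ : ∃ i₀, Finset.univ.filter (fun i => 0 < hH.eigenvalues i) = {i₀} := by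
    rw [← Finset.card_eq_one]
    rw [HasExactlyOnePosEigenvalue, hH.roots_charpoly_eq_eigenvalues, Multiset.filter_map,
      Multiset.card_map] at h
    exact h
  let U : Matrix V V ℝ := hH.eigenvectorUnitary
  have hspec : B = U * Matrix.diagonal hH.eigenvalues * U.transpose :=
    hH.spectral_theorem.trans (Unitary.conjStarAlgAut_apply ..)
  have hdiag (w : V → ℝ) :
      B.toBilin' w w = ∑ i, hH.eigenvalues i * U.transpose.mulVec w i ^ 2 := by
    rw [Matrix.toBilin'_apply']
    nth_rewrite 1 [hspec]
    rw [← Matrix.mulVec_mulVec, ← Matrix.mulVec_mulVec, Matrix.dotProduct_mulVec,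
      ← Matrix.mulVec_transpose, dotProduct]
    refine Finset.sum_congr rfl fun i _ => ?_
    rw [Matrix.mulVec_diagonal]
    ring
  refine ⟨LinearMap.proj i₀ ∘ₗ U.transpose.mulVecLin, fun w hw => ?_⟩
  have hw₀ : U.transpose.mulVec w i₀ = 0 := hw
  rw [hdiag]
  refine Finset.sum_nonpos fun i _ => ?_
  rcases eq_or_ne i i₀ with rfl | hi
  · simp [hw₀]
  · have hneg : ¬ 0 < hH.eigenvalues i := fun hpos => hi <| by
      have hmem : i ∈ Finset.univ.filter fun i => 0 < hH.eigenvalues i :=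
        Finset.mem_filter.2 ⟨Finset.mem_univ i, hpos⟩
      rwa [hi₀, Finset.mem_singleton] at hmem
    exact mul_nonpos_of_nonpos_of_nonneg (not_lt.1 hneg) (sq_nonneg _)

theorem isSymm_toBilin' {R : Type*} [CommSemiring R] {B : Matrix V V R} (hB : B.IsSymm) :
    B.toBilin'.IsSymm where
  eq x y := by
    rw [Matrix.toBilin'_apply, Matrix.toBilin'_apply, Finset.sum_comm]
    refine Finset.sum_congr rfl fun i _ => Finset.sum_congr rfl fun j _ => ?_
    rw [hB.apply, mul_right_comm, mul_comm (x j), mul_right_comm]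

theorem re_sum_mul_mul_eq (B : Matrix V V ℝ) (z : V → ℂ) :
    (∑ i, ∑ j, z i * B i j * z j).re =
      B.toBilin' (fun j => (z j).re) (fun j => (z j).re) -
        B.toBilin' (fun j => (z j).im) (fun j => (z j).im) := by
  simp only [Matrix.toBilin'_apply, Complex.re_sum, ← Finset.sum_sub_distrib]
  exact Finset.sum_congr rfl fun i _ => Finset.sum_congr rfl fun j _ => by simp

theorem im_sum_mul_mul_eq {B : Matrix V V ℝ} (hB : B.IsSymm) (z : V → ℂ) :
    (∑ i, ∑ j, z i * B i j * z j).im =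
      2 * B.toBilin' (fun j => (z j).re) (fun j => (z j).im) := by
  rw [two_mul]
  nth_rewrite 1 [← (isSymm_toBilin' hB).eq]
  simp only [Matrix.toBilin'_apply, Complex.im_sum, ← Finset.sum_add_distrib]
  refine Finset.sum_congr rfl fun i _ => Finset.sum_congr rfl fun j _ => ?_
  simp only [Complex.mul_im, Complex.mul_re, Complex.ofReal_re, Complex.ofReal_im, mul_zero,
    sub_zero, zero_add]
  ring

theorem IsLorentzian.toBilin'_re_le_norm {B : Matrix V V ℝ} (hL : IsLorentzian B.toBilin')
    (hB : B.IsSymm) {z : V → ℂ}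
    (hz : 0 ≤ B.toBilin' (fun j => (z j).re) (fun j => (z j).re)) :
    B.toBilin' (fun j => (z j).re) (fun j => (z j).re) ≤ ‖∑ i, ∑ j, z i * B i j * z j‖ := by
  refine (sq_le_sq₀ hz (norm_nonneg _)).1 ?_
  rw [Complex.sq_norm, Complex.normSq_apply, re_sum_mul_mul_eq, im_sum_mul_mul_eq hB, ← sq, ← sq]
  exact hL.sq_le_sq_sub_add_sq (isSymm_toBilin' hB) hz _

end Lorentzian

section StableExamples

open MvPolynomial

theorem coeff_mul_nonneg {σ R : Type*} [CommSemiring R] [PartialOrder R] [IsOrderedRing R]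
    {p q : MvPolynomial σ R} (hp : ∀ m, 0 ≤ p.coeff m) (hq : ∀ m, 0 ≤ q.coeff m) (m : σ →₀ ℕ) :
    0 ≤ (p * q).coeff m := by
  classical
  rw [coeff_mul]
  exact Finset.sum_nonneg fun a _ => mul_nonneg (hp _) (hq _)

theorem coeff_X_nonneg {σ R : Type*} [CommSemiring R] [PartialOrder R] [IsOrderedRing R] (i : σ)
    (m : σ →₀ ℕ) : 0 ≤ (X i : MvPolynomial σ R).coeff m := by
  classical
  rw [coeff_X]
  split_ifs
  exacts [zero_le_one, le_rfl]

theorem degreeOf_X_le {σ R : Type*} [CommSemiring R] (i j : σ) :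
    degreeOf i (X j : MvPolynomial σ R) ≤ 1 := by
  classical
  rw [degreeOf_le_iff, X]
  intro m hm
  rw [Finset.mem_singleton.1 (support_monomial_subset hm), Finsupp.single_apply]
  split_ifs <;> simp

theorem isStableForm_one {σ : Type*} : IsStableForm (1 : MvPolynomial σ ℝ) 0 where
  coeff_nonneg m := by
    classical
    rw [coeff_one]
    split_ifs
    exacts [zero_le_one, le_rfl]
  isHomogeneous := isHomogeneous_one _ _
  le_norm_of_pos z _ := by simp

theorem IsStableForm.mul {σ : Type*} {p q : MvPolynomial σ ℝ} {e f : ℕ} (hp : IsStableForm p e)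
    (hq : IsStableForm q f) : IsStableForm (p * q) (e + f) where
  coeff_nonneg := coeff_mul_nonneg hp.coeff_nonneg hq.coeff_nonneg
  isHomogeneous := hp.isHomogeneous.mul hq.isHomogeneous
  le_norm_of_pos z hz := by
    rw [map_mul, map_mul, norm_mul]
    exact mul_le_mul (hp.le_norm_of_pos z hz) (hq.le_norm_of_pos z hz)
      (aeval_nonneg_of_coeff_nonneg hq.coeff_nonneg fun j => (hz j).le) (norm_nonneg _)

theorem IsStableForm.pow {σ : Type*} {p : MvPolynomial σ ℝ} {e : ℕ} (hp : IsStableForm p e)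
    (k : ℕ) : IsStableForm (p ^ k) (e * k) := by
  induction k with
  | zero => simpa using isStableForm_one
  | succ k ih => rw [pow_succ, Nat.mul_succ]; exact ih.mul hp

variable {V R : Type*} [Fintype V] [CommSemiring R]

theorem isStableForm_sum_X : IsStableForm (∑ i : V, X i) 1 where
  coeff_nonneg m := by
    rw [coeff_sum]
    exact Finset.sum_nonneg fun i _ => coeff_X_nonneg i m
  isHomogeneous := IsHomogeneous.sum _ _ _ fun i _ => isHomogeneous_X _ _
  le_norm_of_pos z _ := by
    simp only [map_sum, aeval_X, ← Complex.re_sum]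
    exact Complex.re_le_norm _

theorem degreeOf_sum_X_le (i : V) : degreeOf i (∑ j, X j : MvPolynomial V R) ≤ 1 :=
  (degreeOf_sum_le _ _ _).trans (Finset.sup_le fun j _ => degreeOf_X_le i j)

variable [LinearOrder V]

theorem sum_sum_eq_two_mul_sum_lt {A : Type*} [Semiring A] {f : V → V → A}
    (hsymm : ∀ i j, f i j = f j i) (hdiag : ∀ i, f i i = 0) :
    ∑ i, ∑ j, f i j = 2 * ∑ e : V × V with e.1 < e.2, f e.1 e.2 := by
  have hswap : ∑ e : V × V with e.2 < e.1, f e.1 e.2 = ∑ e : V × V with e.1 < e.2, f e.1 e.2 :=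
    Finset.sum_equiv (Equiv.prodComm V V) (by simp) fun e _ => hsymm e.1 e.2
  have hupper : ∑ e : V × V with ¬ e.1 < e.2, f e.1 e.2 =
      ∑ e : V × V with e.2 < e.1, f e.1 e.2 := by
    refine (Finset.sum_subset (fun e he => ?_) fun e he he' => ?_).symm
    · simpa using (Finset.mem_filter.1 he).2.le
    · simp only [Finset.mem_filter, Finset.mem_univ, true_and, not_lt] at he he'
      rw [le_antisymm he he', hdiag]
  rw [← Fintype.sum_prod_type', ← Finset.sum_filter_add_sum_filter_not Finset.univ
    (fun e : V × V => e.1 < e.2), hupper, hswap, two_mul]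

/-- The quadratic form `∑_{i < j} B i j * X i * X j`, whose monomials are the edges of the complete
graph on `V` weighted by `B`. -/
noncomputable def edgeForm (B : Matrix V V R) : MvPolynomial V R :=
  ∑ e : V × V with e.1 < e.2, C (B e.1 e.2) * (X e.1 * X e.2)

theorem isHomogeneous_edgeForm (B : Matrix V V R) : (edgeForm B).IsHomogeneous 2 :=
  IsHomogeneous.sum _ _ _ fun e _ => by
    simpa using (isHomogeneous_C V (B e.1 e.2)).mul
      ((isHomogeneous_X R e.1).mul (isHomogeneous_X R e.2))

theorem degreeOf_edgeForm_le (B : Matrix V V R) (i : V) : degreeOf i (edgeForm B) ≤ 1 := by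
  refine (degreeOf_sum_le _ _ _).trans (Finset.sup_le fun e he => ?_)
  have hne : e.1 ≠ e.2 := (Finset.mem_filter.1 he).2.ne
  refine (degreeOf_C_mul_le _ _ _).trans ((degreeOf_mul_le _ _ _).trans ?_)
  rcases eq_or_ne i e.1 with rfl | hi
  · rw [degreeOf_X_of_ne hne, add_zero]
    exact degreeOf_X_le _ _
  · rw [degreeOf_X_of_ne hi, zero_add]
    exact degreeOf_X_le _ _

theorem two_mul_aeval_edgeForm {A : Type*} [CommSemiring A] [Algebra R A] {B : Matrix V V R}
    (hB : B.IsSymm) (hdiag : ∀ i, B i i = 0) (w : V → A) :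
    2 * aeval w (edgeForm B) = ∑ i, ∑ j, w i * algebraMap R A (B i j) * w j := by
  rw [sum_sum_eq_two_mul_sum_lt (fun i j => by rw [← hB.apply i j]; ring)
    fun i => by simp [hdiag]]
  simp only [edgeForm, map_sum, map_mul, aeval_X, algHom_C]
  exact congrArg _ (Finset.sum_congr rfl fun e _ => by ring)

theorem isStableForm_edgeForm {B : Matrix V V ℝ} (hL : IsLorentzian B.toBilin') (hB : B.IsSymm)
    (hdiag : ∀ i, B i i = 0) (hnonneg : ∀ i j, 0 ≤ B i j) : IsStableForm (edgeForm B) 2 where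
  coeff_nonneg m := by
    rw [edgeForm, coeff_sum]
    refine Finset.sum_nonneg fun e _ => ?_
    rw [coeff_C_mul]
    exact mul_nonneg (hnonneg _ _) (coeff_mul_nonneg (coeff_X_nonneg _) (coeff_X_nonneg _) m)
  isHomogeneous := isHomogeneous_edgeForm B
  le_norm_of_pos z hz := by
    have hre : 2 * aeval (fun j => (z j).re) (edgeForm B) =
        B.toBilin' (fun j => (z j).re) (fun j => (z j).re) := by
      rw [two_mul_aeval_edgeForm hB hdiag, Matrix.toBilin'_apply]
      rfl
    have hpos : 0 ≤ B.toBilin' (fun j => (z j).re) (fun j => (z j).re) := by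
      rw [Matrix.toBilin'_apply]
      exact Finset.sum_nonneg fun i _ => Finset.sum_nonneg fun j _ =>
        mul_nonneg (mul_nonneg (hz i).le (hnonneg i j)) (hz j).le
    have hnorm := hL.toBilin'_re_le_norm hB hpos
    rw [← hre, ← Complex.coe_algebraMap, ← two_mul_aeval_edgeForm hB hdiag, norm_mul,
      Complex.norm_two] at hnorm
    exact le_of_mul_le_mul_left hnorm two_pos

end StableExamples

section Matchings

/-- If all the summands have square zero, then only squarefree products survive in a power of the
sum, each of them once for every order of its factors. -/
theorem sum_pow_eq_factorial_mul_esymm {A : Type*} [CommRing A] {s : Multiset A}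
    (hs : ∀ a ∈ s, a ^ 2 = 0) (k : ℕ) : s.sum ^ k = k.factorial * s.esymm k := by
  induction s using Multiset.induction_on generalizing k with
  | empty =>
    cases k with
    | zero => simp [Multiset.esymm]
    | succ k => simp [Multiset.esymm, Multiset.powersetCard_zero_right]
  | cons a s ih =>
    cases k with
    | zero => simp [Multiset.esymm]
    | succ k =>
      have ih := ih fun b hb => hs b (Multiset.mem_cons_of_mem hb)
      have hpow : (s.sum + a) ^ (k + 1) = s.sum ^ (k + 1) + (k + 1) * s.sum ^ k * a := by
        simpa using Polynomial.eval_add_of_sq_eq_zero (Polynomial.X ^ (k + 1)) s.sum a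
          (hs a (Multiset.mem_cons_self a s))
      have hesymm : (a ::ₘ s).esymm (k + 1) = s.esymm (k + 1) + a * s.esymm k := by
        simp [Multiset.esymm, Multiset.powersetCard_cons, Multiset.sum_map_mul_left]
      rw [Multiset.sum_cons, add_comm, hpow, ih, ih, hesymm, Nat.factorial_succ]
      push_cast
      ring

theorem sum_pow_eq_factorial_mul_sum_prod {ι A : Type*} [CommRing A] {s : Finset ι} {w : ι → A}
    (hw : ∀ i ∈ s, w i ^ 2 = 0) (k : ℕ) :
    (∑ i ∈ s, w i) ^ k = k.factorial * ∑ M ∈ s.powersetCard k, ∏ i ∈ M, w i := by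
  rw [← Finset.esymm_map_val, ← sum_pow_eq_factorial_mul_esymm (by simpa using hw)]
  rfl

variable {V : Type*} [LinearOrder V]

/-- The number of edges of `M` at the vertex `v`. -/
def edgeCount (M : Finset (V × V)) (v : V) : ℕ := (M.filter fun e => v = e.1 ∨ v = e.2).card

/-- The edges of the complete graph on the vertex subset `S`, as edges on the whole vertex set. -/
def edgeEmbedding (S : Finset V) : S × S ↪ V × V :=
  (Function.Embedding.subtype _).prodMap (Function.Embedding.subtype _)

theorem edgeCount_map_edgeEmbedding {S : Finset V} (M : Finset (S × S)) (v : S) :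
    edgeCount (M.map (edgeEmbedding S)) v = edgeCount M v := by
  rw [edgeCount, Finset.filter_map, Finset.card_map, edgeCount]
  congr 2
  ext e
  exact or_congr Subtype.ext_iff.symm Subtype.ext_iff.symm

theorem edgeCount_eq_zero_iff {M : Finset (V × V)} {v : V} :
    edgeCount M v = 0 ↔ ∀ e ∈ M, v ≠ e.1 ∧ v ≠ e.2 := by
  simp only [edgeCount, Finset.card_eq_zero, Finset.filter_eq_empty_iff, not_or, ne_eq]

variable [Fintype V]

theorem sum_edgeCount {M : Finset (V × V)} (hM : ∀ e ∈ M, e.1 < e.2) :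
    ∑ v, edgeCount M v = 2 * M.card := by
  have hends (e : V × V) : ({v | v = e.1 ∨ v = e.2} : Finset V) = {e.1, e.2} := by ext; simp
  calc ∑ v, edgeCount M v = ∑ e ∈ M, ({v | v = e.1 ∨ v = e.2} : Finset V).card := by
        simp only [edgeCount, Finset.card_filter]
        exact Finset.sum_comm
    _ = 2 * M.card := by
        rw [mul_comm, Finset.sum_const_nat fun e he => by
          rw [hends, Finset.card_pair (hM e he).ne]]

/-- The matchings of the complete graph on `V` whose set of covered vertices is `S`. -/
def matchingsCovering (S : Finset V) : Finset (Finset (V × V)) :=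
  {M | (∀ e ∈ M, e.1 < e.2) ∧ ∀ v, edgeCount M v = if v ∈ S then 1 else 0}

theorem mem_matchingsCovering {S : Finset V} {M : Finset (V × V)} :
    M ∈ matchingsCovering S ↔
      (∀ e ∈ M, e.1 < e.2) ∧ ∀ v, edgeCount M v = if v ∈ S then 1 else 0 := by
  simp [matchingsCovering]

theorem two_mul_card_of_mem_matchingsCovering {S : Finset V} {M : Finset (V × V)}
    (hM : M ∈ matchingsCovering S) : 2 * M.card = S.card := by
  obtain ⟨hlt, hcount⟩ := mem_matchingsCovering.1 hM
  simp [← sum_edgeCount hlt, hcount]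

theorem map_edgeEmbedding_mem_matchingsCovering {S : Finset V} {M : Finset (S × S)} :
    M.map (edgeEmbedding S) ∈ matchingsCovering S ↔ M ∈ perfectMatchings S := by
  have hcovered : (∀ v, edgeCount (M.map (edgeEmbedding S)) v = if v ∈ S then 1 else 0) ↔
      ∀ v : S, edgeCount M v = 1 := by
    refine ⟨fun h v => ?_, fun h v => ?_⟩
    · rw [← edgeCount_map_edgeEmbedding, h, if_pos v.2]
    · split_ifs with hv
      · exact (edgeCount_map_edgeEmbedding M ⟨v, hv⟩).trans (h _)
      · refine edgeCount_eq_zero_iff.2 fun e he => ?_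
        obtain ⟨e, -, rfl⟩ := Finset.mem_map.1 he
        exact ⟨fun h => hv (h ▸ e.1.2), fun h => hv (h ▸ e.2.2)⟩
  rw [mem_matchingsCovering, hcovered, Finset.forall_mem_map]
  simp only [perfectMatchings, Finset.mem_filter, Finset.mem_univ, true_and]
  rfl

theorem exists_map_edgeEmbedding_eq {S : Finset V} {M : Finset (V × V)}
    (hM : M ∈ matchingsCovering S) : ∃ M' : Finset (S × S), M'.map (edgeEmbedding S) = M := by
  have hmem {e : V × V} (he : e ∈ M) {v : V} (hv : v = e.1 ∨ v = e.2) : v ∈ S := by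
    by_contra hvS
    have hcount := (mem_matchingsCovering.1 hM).2 v
    rw [if_neg hvS, edgeCount_eq_zero_iff] at hcount
    exact not_or.2 (hcount e he) hv
  have hsub : M ⊆ Finset.univ.map (edgeEmbedding S) := fun e he =>
    Finset.mem_map.2
      ⟨(⟨e.1, hmem he (.inl rfl)⟩, ⟨e.2, hmem he (.inr rfl)⟩), Finset.mem_univ _, rfl⟩
  obtain ⟨M', -, rfl⟩ := Finset.subset_map_iff.1 hsub
  exact ⟨M', rfl⟩

variable {R : Type*}

theorem haf_submatrix_eq_sum [CommSemiring R] (B : Matrix V V R) (S : Finset V) :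
    haf (B.submatrix (fun i : S => (i : V)) (fun i : S => (i : V))) =
      ∑ M ∈ matchingsCovering S, ∏ e ∈ M, B e.1 e.2 := by
  refine Finset.sum_bij (fun M _ => M.map (edgeEmbedding S))
    (fun M hM => map_edgeEmbedding_mem_matchingsCovering.2 hM)
    (fun M _ N _ h => Finset.map_injective _ h) (fun M hM => ?_) fun M _ => ?_
  · obtain ⟨M, rfl⟩ := exists_map_edgeEmbedding_eq hM
    exact ⟨M, map_edgeEmbedding_mem_matchingsCovering.1 hM, rfl⟩
  · rw [Finset.prod_map]
    rfl

theorem mem_matchingsCovering_compl_iff {T : Finset V} {k : ℕ}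
    (hT : 2 * k + T.card = Fintype.card V) {M : Finset (V × V)} :
    M ∈ matchingsCovering Tᶜ ↔
      M ∈ Finset.powersetCard k {e : V × V | e.1 < e.2} ∧
        ∀ v, edgeCount M v + (if v ∈ T then 1 else 0) = 1 := by
  have hcovered : (∀ v, edgeCount M v = if v ∈ Tᶜ then 1 else 0) ↔
      ∀ v, edgeCount M v + (if v ∈ T then 1 else 0) = 1 :=
    forall_congr' fun v => by by_cases hv : v ∈ T <;> simp [hv]
  rw [Finset.mem_powersetCard, Finset.subset_iff]
  simp only [Finset.mem_filter, Finset.mem_univ, true_and, ← hcovered]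
  refine ⟨fun hM => ?_, fun hM => mem_matchingsCovering.2 ⟨hM.1.1, hM.2⟩⟩
  have hcard := two_mul_card_of_mem_matchingsCovering hM
  rw [Finset.card_compl] at hcard
  obtain ⟨hlt, hcount⟩ := mem_matchingsCovering.1 hM
  exact ⟨⟨hlt, by omega⟩, hcount⟩

theorem hafK_eq_sum_sum [CommSemiring R] (B : Matrix V V R) {k l : ℕ}
    (hkl : 2 * k + l = Fintype.card V) :
    hafK k B = ∑ M ∈ Finset.powersetCard k {e : V × V | e.1 < e.2},
      ∑ T ∈ Finset.powersetCard l Finset.univ,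
        if ∀ v, edgeCount M v + (if v ∈ T then 1 else 0) = 1 then ∏ e ∈ M, B e.1 e.2 else 0 := by
  rw [hafK, Finset.sum_comm]
  refine Finset.sum_bijective compl compl_bijective (fun S => ?_) fun S hS => ?_
  · have := Finset.card_le_univ S
    simp only [Finset.mem_powersetCard_univ, Finset.card_compl]
    omega
  · rw [Finset.mem_powersetCard_univ] at hS
    have hcard : 2 * k + Sᶜ.card = Fintype.card V := by rw [← hS, Finset.card_add_card_compl]
    rw [haf_submatrix_eq_sum, ← Finset.sum_filter]
    refine Finset.sum_congr ?_ fun _ _ => rfl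
    ext M
    rw [Finset.mem_filter, ← mem_matchingsCovering_compl_iff hcard, compl_compl]

end Matchings

section MatchingPolynomial

open MvPolynomial

variable {V R : Type*} [CommRing R]

/-- The ideal generated by the squares of the variables. Modulo it a polynomial is determined by
its multilinear part. -/
noncomputable def squaresIdeal (V R : Type*) [CommRing R] : Ideal (MvPolynomial V R) :=
  Ideal.span ((fun m => monomial m (1 : R)) '' Set.range fun i : V => Finsupp.single i 2)

theorem X_sq_mem_squaresIdeal (i : V) : (X i ^ 2 : MvPolynomial V R) ∈ squaresIdeal V R :=
  Ideal.subset_span ⟨_, ⟨i, rfl⟩, X_pow_eq_monomial.symm⟩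

theorem coeff_eq_of_sub_mem_squaresIdeal {p q : MvPolynomial V R} (h : p - q ∈ squaresIdeal V R)
    {m : V →₀ ℕ} (hm : ∀ i, m i ≤ 1) : p.coeff m = q.coeff m := by
  by_contra hne
  have hsupp : m ∈ (p - q).support := by
    rwa [mem_support_iff, coeff_sub, sub_ne_zero]
  obtain ⟨_, ⟨i, rfl⟩, hi⟩ := mem_ideal_span_monomial_image.1 h m hsupp
  have htwo : 2 ≤ m i := by simpa using hi i
  exact absurd (htwo.trans (hm i)) (by norm_num)

theorem sum_single_one_apply [Fintype V] (i : V) : (∑ j, Finsupp.single j 1 : V →₀ ℕ) i = 1 := by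
  classical
  simp [Finsupp.finsetSum_apply, Finsupp.single_apply]

theorem prod_edges_mul_prod_X_eq_monomial (B : Matrix V V R) (M : Finset (V × V)) (T : Finset V) :
    (∏ e ∈ M, C (B e.1 e.2) * (X e.1 * X e.2)) * ∏ i ∈ T, X i =
      monomial (∑ e ∈ M, (Finsupp.single e.1 1 + Finsupp.single e.2 1) +
        ∑ i ∈ T, Finsupp.single i 1) (∏ e ∈ M, B e.1 e.2) := by
  have hedge (e : V × V) : (C (B e.1 e.2) * (X e.1 * X e.2) : MvPolynomial V R) =
      monomial (Finsupp.single e.1 1 + Finsupp.single e.2 1) (B e.1 e.2) := by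
    simp only [X, C_mul_monomial, monomial_mul, mul_one]
  simp_rw [hedge]
  rw [← monomial_sum_prod, show (∏ i ∈ T, X i : MvPolynomial V R) = monomial _ 1 from
    (monomial_sum_one T fun i => Finsupp.single i 1).symm, monomial_mul, mul_one]

variable [LinearOrder V]

theorem sum_single_add_single_apply {M : Finset (V × V)} (hM : ∀ e ∈ M, e.1 < e.2) (v : V) :
    (∑ e ∈ M, (Finsupp.single e.1 1 + Finsupp.single e.2 1) : V →₀ ℕ) v = edgeCount M v := by
  rw [Finsupp.finsetSum_apply, edgeCount, Finset.card_filter]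
  refine Finset.sum_congr rfl fun e he => ?_
  rcases eq_or_ne v e.1 with rfl | hv
  · simp [(hM e he).ne']
  · simp [Finsupp.single_apply, hv, eq_comm]

variable [Fintype V]

theorem coeff_prod_edges_mul_prod_X (B : Matrix V V R) {M : Finset (V × V)}
    (hM : ∀ e ∈ M, e.1 < e.2) (T : Finset V) :
    ((∏ e ∈ M, C (B e.1 e.2) * (X e.1 * X e.2)) * ∏ i ∈ T, X i : MvPolynomial V R).coeff
        (∑ j, Finsupp.single j 1) =
      if ∀ v, edgeCount M v + (if v ∈ T then 1 else 0) = 1 then ∏ e ∈ M, B e.1 e.2 else 0 := by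
  have hT (v : V) : (∑ i ∈ T, Finsupp.single i 1 : V →₀ ℕ) v = if v ∈ T then 1 else 0 := by
    simp [Finsupp.finsetSum_apply, Finsupp.single_apply]
  rw [prod_edges_mul_prod_X_eq_monomial, coeff_monomial]
  simp only [Finsupp.ext_iff, Finsupp.add_apply, sum_single_add_single_apply hM, hT,
    sum_single_one_apply]

theorem coeff_edgeForm_pow_mul_sum_X_pow (B : Matrix V V R) {k l : ℕ}
    (hkl : 2 * k + l = Fintype.card V) :
    (edgeForm B ^ k * (∑ i, X i) ^ l).coeff (∑ j, Finsupp.single j 1) =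
      k.factorial * l.factorial * hafK k B := by
  let π := Ideal.Quotient.mk (squaresIdeal V R)
  have hX (i : V) : π (X i) ^ 2 = 0 :=
    Ideal.Quotient.eq_zero_iff_mem.2 (X_sq_mem_squaresIdeal i)
  have hedge (e : V × V) : π (C (B e.1 e.2) * (X e.1 * X e.2)) ^ 2 = 0 := by
    rw [map_mul, map_mul, mul_pow, mul_pow, hX, zero_mul, mul_zero]
  have hexpand : π (edgeForm B ^ k * (∑ i, X i) ^ l) = π (C (k.factorial * l.factorial : R) *
      ∑ M ∈ Finset.powersetCard k {e : V × V | e.1 < e.2},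
        ∑ T ∈ Finset.powersetCard l Finset.univ,
          (∏ e ∈ M, C (B e.1 e.2) * (X e.1 * X e.2)) * ∏ i ∈ T, X i) := by
    rw [map_mul, map_pow, map_pow, edgeForm, map_sum, map_sum,
      sum_pow_eq_factorial_mul_sum_prod fun e _ => hedge e,
      sum_pow_eq_factorial_mul_sum_prod fun i _ => hX i, ← Finset.sum_mul_sum]
    simp only [map_mul, map_sum, map_prod, map_natCast]
    ring
  rw [coeff_eq_of_sub_mem_squaresIdeal (Ideal.Quotient.eq.1 hexpand)
    fun i => (sum_single_one_apply i).le, coeff_C_mul, hafK_eq_sum_sum B hkl]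
  simp only [coeff_sum]
  refine congrArg _ (Finset.sum_congr rfl fun M hM => Finset.sum_congr rfl fun T _ => ?_)
  refine coeff_prod_edges_mul_prod_X B (fun e he => ?_) T
  exact (Finset.mem_filter.1 ((Finset.mem_powersetCard.1 hM).1 he)).2

end MatchingPolynomial

section Capacity

open MvPolynomial

variable {V : Type*} [Fintype V]

theorem card_mul_geom_mean_le_sum [Nonempty V] {x : V → ℝ} (hx : ∀ j, 0 < x j) :
    Fintype.card V * (∏ j, x j) ^ (Fintype.card V : ℝ)⁻¹ ≤ ∑ j, x j := by
  have hcard : (0 : ℝ) < Fintype.card V := by exact_mod_cast Fintype.card_pos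
  have hamgm := Real.geom_mean_le_arith_mean Finset.univ (fun _ => 1) x (fun _ _ => zero_le_one)
    (by simpa using hcard) fun j _ => (hx j).le
  simpa [le_div_iff₀' hcard] using hamgm

theorem prod_mul_rpow_of_mem_doublyStochastic [DecidableEq V] {B : Matrix V V ℝ}
    (hB : B ∈ doublyStochastic ℝ V) {x : V → ℝ} (hx : ∀ j, 0 < x j) :
    ∏ e : V × V, (x e.1 * x e.2) ^ B e.1 e.2 = (∏ j, x j) ^ 2 := by
  have hrow (i : V) : ∏ j, x i ^ B i j = x i := by
    rw [← Real.rpow_sum_of_pos (hx i), sum_row_of_mem_doublyStochastic hB, Real.rpow_one]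
  have hcol (j : V) : ∏ i, x j ^ B i j = x j := by
    rw [← Real.rpow_sum_of_pos (hx j), sum_col_of_mem_doublyStochastic hB, Real.rpow_one]
  simp only [Real.mul_rpow (hx _).le (hx _).le, Finset.prod_mul_distrib, Fintype.prod_prod_type,
    hrow]
  rw [Finset.prod_comm, Finset.prod_congr rfl fun j _ => hcol j, sq]

theorem card_mul_geom_mean_sq_le_sum [Nonempty V] [DecidableEq V] {B : Matrix V V ℝ}
    (hB : B ∈ doublyStochastic ℝ V) {x : V → ℝ} (hx : ∀ j, 0 < x j) :
    Fintype.card V * ((∏ j, x j) ^ (Fintype.card V : ℝ)⁻¹) ^ 2 ≤ ∑ i, ∑ j, x i * B i j * x j := by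
  have hcard : (0 : ℝ) < Fintype.card V := by exact_mod_cast Fintype.card_pos
  have hweight : ∑ e : V × V, B e.1 e.2 = Fintype.card V := by
    simp [Fintype.sum_prod_type, sum_row_of_mem_doublyStochastic hB]
  have hamgm := Real.geom_mean_le_arith_mean Finset.univ (fun e : V × V => B e.1 e.2)
    (fun e => x e.1 * x e.2) (fun e _ => nonneg_of_mem_doublyStochastic hB)
    (by rwa [hweight]) fun e _ => (mul_pos (hx _) (hx _)).le
  rw [prod_mul_rpow_of_mem_doublyStochastic hB hx, hweight, le_div_iff₀' hcard,
    Fintype.sum_prod_type, ← Real.rpow_pow_comm (Finset.prod_nonneg fun j _ => (hx j).le)]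
    at hamgm
  simpa [mul_left_comm, mul_assoc] using hamgm

variable [LinearOrder V]

theorem degreeOf_edgeForm_pow_mul_sum_X_pow_le {R : Type*} [CommSemiring R] (B : Matrix V V R)
    (k l : ℕ) (i : V) : degreeOf i (edgeForm B ^ k * (∑ j, X j) ^ l) ≤ k + l := by
  refine (degreeOf_mul_le _ _ _).trans (add_le_add ?_ ?_)
  · exact (degreeOf_pow_le _ _ _).trans (mul_le_of_le_one_right' (degreeOf_edgeForm_le B i))
  · exact (degreeOf_pow_le _ _ _).trans (mul_le_of_le_one_right' (degreeOf_sum_X_le i))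

theorem mul_prod_le_aeval_edgeForm_pow_mul_sum_X_pow [Nonempty V] {B : Matrix V V ℝ}
    (hB : B ∈ doublyStochastic ℝ V) (hsymm : B.IsSymm) (hdiag : ∀ i, B i i = 0) {k l : ℕ}
    (hkl : 2 * k + l = Fintype.card V) {x : V → ℝ} (hx : ∀ j, 0 < x j) :
    (Fintype.card V / 2 : ℝ) ^ k * Fintype.card V ^ l * ∏ j, x j ≤
      aeval x (edgeForm B ^ k * (∑ j, X j) ^ l) := by
  have hprod : 0 < ∏ j, x j := Finset.prod_pos fun j _ => hx j
  set N : ℝ := (Fintype.card V : ℝ) with hN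
  set G : ℝ := (∏ j, x j) ^ N⁻¹ with hG
  have : 0 < G := Real.rpow_pos_of_pos hprod _
  have hGpow : ∏ j, x j = (G ^ 2) ^ k * G ^ l := by
    rw [← pow_mul, ← pow_add, hkl, hG, hN, Real.rpow_inv_natCast_pow hprod.le Fintype.card_ne_zero]
  have hlinear : N * G ≤ aeval x (∑ j, X j : MvPolynomial V ℝ) := by
    simpa using card_mul_geom_mean_le_sum hx
  have hquadratic : N / 2 * G ^ 2 ≤ aeval x (edgeForm B) := by
    have htwo := (card_mul_geom_mean_sq_le_sum hB hx).trans_eq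
      (two_mul_aeval_edgeForm hsymm hdiag x).symm
    linarith
  calc (N / 2) ^ k * N ^ l * ∏ j, x j = (N / 2 * G ^ 2) ^ k * (N * G) ^ l := by
        rw [hGpow, mul_pow, mul_pow]
        ring
    _ ≤ aeval x (edgeForm B) ^ k * aeval x (∑ j, X j : MvPolynomial V ℝ) ^ l := by
        have : 0 ≤ aeval x (edgeForm B) := hquadratic.trans' (by positivity)
        gcongr
    _ = aeval x (edgeForm B ^ k * (∑ j, X j) ^ l) := by simp only [map_mul, map_pow]

end Capacity

section Bound

/-- The lower bound for `hafK k B` when `B` has order `N`. It is meaningful for `2 * k ≤ N`, where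
no subtraction in it is truncated. -/
noncomputable def matchingBound (N k : ℕ) : ℝ :=
  N ^ (N - 2 * k) * (N - k).factorial * N ^ k /
      ((N - 2 * k).factorial * (N - k) ^ (N - k) * 2 ^ k * k.factorial) *
    ((N - k - 1) / (N - k)) ^ ((N - k - 1) * k)

theorem factorial_mul_factorial_mul_matchingBound {N k l : ℕ} (hkl : 2 * k + l = N) :
    k.factorial * l.factorial * matchingBound N k =
      (N / 2) ^ k * N ^ l * ((k + l).factorial / (k + l : ℕ) ^ (k + l) *
        capacityFactor (k + l) ^ k) := by
  have hsub : N - k = k + l := by omega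
  have hsub_two : N - 2 * k = l := by omega
  have hcast : (N : ℝ) - k = (k + l : ℕ) := by rw [← hkl]; push_cast; ring
  rw [matchingBound, capacityFactor, hsub, hsub_two, hcast, div_pow (N : ℝ), ← pow_mul]
  field_simp

theorem matchingBound_two_mul_self {n : ℕ} (hn : 1 ≤ n) :
    matchingBound (2 * n) n = (((n : ℝ) - 1) / n) ^ ((n - 1) * n) := by
  have : (0 : ℝ) < n := by exact_mod_cast hn
  have hsub : 2 * n - n = n := by omega
  have hcast : ((2 * n : ℕ) : ℝ) - n = n := by push_cast; ring
  rw [matchingBound, hsub, hcast, Nat.sub_self]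
  push_cast
  rw [pow_zero, Nat.factorial_zero, Nat.cast_one, mul_pow]
  field_simp

theorem theorem2p2_general {V : Type*} [Fintype V] [LinearOrder V] {B : Matrix V V ℝ}
    (hB : B ∈ doublyStochastic ℝ V) (hsymm : B.IsSymm) (hdiag : ∀ i, B i i = 0)
    (hpos : HasExactlyOnePosEigenvalue B) {k : ℕ} (hk : 2 * k ≤ Fintype.card V) :
    matchingBound (Fintype.card V) k ≤ hafK k B := by
  obtain ⟨l, hkl⟩ := Nat.exists_eq_add_of_le hk
  replace hkl := hkl.symm
  have : Nonempty V := by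
    by_contra hempty
    rw [not_nonempty_iff] at hempty
    simp [HasExactlyOnePosEigenvalue] at hpos
  have hstable : IsStableForm (edgeForm B ^ k * (∑ i, MvPolynomial.X i) ^ l)
      (Finset.univ : Finset V).card := by
    simpa [hkl] using ((isStableForm_edgeForm (hpos.isLorentzian hsymm) hsymm hdiag
      fun _ _ => nonneg_of_mem_doublyStochastic hB).pow k).mul (isStableForm_sum_X.pow l)
  have : (0 : ℝ) < Fintype.card V := by exact_mod_cast Fintype.card_pos
  have hcoeff := hstable.mul_prod_capacityFactor_le_coeff (k + l) Finset.univ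
    (degreeOf_edgeForm_pow_mul_sum_X_pow_le B k l)
    (c := (Fintype.card V / 2 : ℝ) ^ k * Fintype.card V ^ l) (by positivity)
    fun x hx => mul_prod_le_aeval_edgeForm_pow_mul_sum_X_pow hB hsymm hdiag hkl hx
  rw [coeff_edgeForm_pow_mul_sum_X_pow B hkl, Finset.card_univ,
    show Finset.range (Fintype.card V) = Finset.range (k + l + k) by congr 1; omega,
    prod_range_capacityFactor_min, ← factorial_mul_factorial_mul_matchingBound hkl] at hcoeff
  exact le_of_mul_le_mul_left hcoeff (by positivity)

end Bound

theorem Psi_subset_doublyStochastic (n : ℕ) :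
    Psi n ⊆ {B | B ∈ doublyStochastic ℝ (Fin (2 * n)) ∧ B.IsSymm ∧ ∀ i, B i i = 0} := by
  refine convexHull_min ?_ (convex_doublyStochastic.inter ?_)
  · rintro _ ⟨⟨σ, rfl⟩, hsymm, hdiag⟩
    exact ⟨permMatrix_mem_doublyStochastic, hsymm, hdiag⟩
  · rintro P ⟨hP, hPdiag⟩ Q ⟨hQ, hQdiag⟩ a b - - -
    exact ⟨(hP.smul a).add (hQ.smul b), fun i => by simp [hPdiag, hQdiag]⟩

section Asymptotics

open Filter Topology

theorem abs_log_one_sub_inv_add_le {n : ℕ} (hn : 2 ≤ n) :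
    |(n : ℝ) * (n - 1) * Real.log (1 - (n : ℝ)⁻¹) + n - 1 / 2| ≤ 2 / n := by
  have hn_one : (1 : ℝ) < n := by exact_mod_cast hn
  have hn_pos : (0 : ℝ) < n := by linarith
  set r := (n : ℝ)⁻¹ + (n : ℝ)⁻¹ ^ 2 / 2 + Real.log (1 - (n : ℝ)⁻¹) with hr
  have hr_le : |r| ≤ (n : ℝ)⁻¹ ^ 3 / (1 - (n : ℝ)⁻¹) := by
    have hinv : |(n : ℝ)⁻¹| = (n : ℝ)⁻¹ := abs_of_pos (by positivity)
    have hlog := Real.abs_log_sub_add_sum_range_le (hinv.trans_lt (inv_lt_one_of_one_lt₀ hn_one)) 2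
    simpa [hr, Finset.sum_range_succ, hinv, one_add_one_eq_two] using hlog
  have hmain : (n : ℝ) * (n - 1) * Real.log (1 - (n : ℝ)⁻¹) + n - 1 / 2 =
      1 / (2 * n) + n * (n - 1) * r := by
    rw [hr]
    field_simp
    ring
  calc |(n : ℝ) * (n - 1) * Real.log (1 - (n : ℝ)⁻¹) + n - 1 / 2|
      ≤ 1 / (2 * n) + n * (n - 1) * |r| := by
        rw [hmain]
        refine (abs_add_le _ _).trans_eq ?_
        rw [abs_of_pos (by positivity), abs_mul,
          abs_of_nonneg (mul_nonneg hn_pos.le (by linarith))]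
    _ ≤ 1 / (2 * n) + n * (n - 1) * ((n : ℝ)⁻¹ ^ 3 / (1 - (n : ℝ)⁻¹)) := by
        have : 0 ≤ (n : ℝ) - 1 := by linarith
        gcongr
    _ = 3 / 2 / n := by
        have : (n : ℝ) - 1 ≠ 0 := by linarith
        field_simp
        norm_num
    _ ≤ 2 / n := by gcongr; norm_num

theorem isEquivalent_sub_one_div_pow :
    Asymptotics.IsEquivalent atTop (fun n : ℕ => (((n : ℝ) - 1) / n) ^ ((n - 1) * n))
      (fun n : ℕ => Real.exp (-(n : ℝ)) * Real.sqrt (Real.exp 1)) := by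
  have hexponent : Tendsto
      (fun n : ℕ => (n : ℝ) * (n - 1) * Real.log (1 - (n : ℝ)⁻¹) + n - 1 / 2) atTop (𝓝 0) := by
    refine squeeze_zero_norm' ?_ (tendsto_const_div_atTop_nhds_zero_nat 2)
    filter_upwards [eventually_ge_atTop 2] with n hn
    exact abs_log_one_sub_inv_add_le hn
  refine Asymptotics.isEquivalent_of_tendsto_one ?_
  refine ((Real.exp_zero ▸ Real.continuous_exp.tendsto 0).comp hexponent).congr' ?_
  filter_upwards [eventually_ge_atTop 2] with n hn
  have hn_one : (1 : ℝ) < n := by exact_mod_cast hn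
  have hbase : ((n : ℝ) - 1) / n = Real.exp (Real.log (1 - (n : ℝ)⁻¹)) := by
    rw [Real.exp_log (sub_pos.2 (inv_lt_one_of_one_lt₀ hn_one))]
    field_simp
  simp only [Function.comp_apply, Pi.div_apply]
  rw [hbase, ← Real.exp_nat_mul, ← Real.exp_half, ← Real.exp_add, ← Real.exp_sub]
  congr 1
  push_cast [Nat.cast_sub (show 1 ≤ n by omega)]
  ring

end Asymptotics

theorem theorem2p2 :
    (∀ (n : ℕ), 1 ≤ n → ∀ B ∈ Psi n, HasExactlyOnePosEigenvalue B →
      (((n : ℝ) - 1) / n) ^ ((n - 1) * n) ≤ hafK n B ∧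
      ∀ k : ℕ, 2 ≤ k → k ≤ n - 1 →
        ((2 * n : ℝ) ^ (2 * n - 2 * k) * ((2 * n - k).factorial : ℝ) * (2 * n : ℝ) ^ k) /
            (((2 * n - 2 * k).factorial : ℝ) * (2 * n - k : ℝ) ^ (2 * n - k) *
              2 ^ k * (k.factorial : ℝ)) *
          ((2 * n - k - 1 : ℝ) / (2 * n - k : ℝ)) ^ ((2 * n - k - 1) * k) ≤ hafK k B) ∧
    Asymptotics.IsEquivalent Filter.atTop
      (fun n : ℕ => (((n : ℝ) - 1) / n) ^ ((n - 1) * n))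
      (fun n : ℕ => Real.exp (-(n : ℝ)) * Real.sqrt (Real.exp 1)) := by
  refine ⟨fun n hn B hB hpos => ?_, isEquivalent_sub_one_div_pow⟩
  obtain ⟨hstoch, hsymm, hdiag⟩ := Psi_subset_doublyStochastic n hB
  have hbound {k : ℕ} (hk : k ≤ n) : matchingBound (2 * n) k ≤ hafK k B := by
    simpa using theorem2p2_general hstoch hsymm hdiag hpos (k := k) (by simpa using hk)
  refine ⟨(matchingBound_two_mul_self hn).symm.trans_le (hbound le_rfl), fun k _ hk => ?_⟩
  simpa only [matchingBound, Nat.cast_mul, Nat.cast_ofNat] using hbound (k := k) (by omega)
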